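/- Let $\mathcal{G}$ be a locally compact Hausdorff étale groupoid with unit space $\mathcal{G}^{(0)}$, source and range maps $\mathrm{s},\mathrm{r}$ and source fibres $\mathcal{G}_x=\mathrm{s}^{-1}(x)$. For $f\in C_c(\mathcal{G})$ and $x\in\mathcal{G}^{(0)}$ let $\lambda_x(f)\in\mathscr{B}(\ell^2(\mathcal{G}_x))$ be given by $(\lambda_x(f)\xi)(\gamma)=\sum_{\alpha\in\mathcal{G}_x}f(\gamma\alpha^{-1})\xi(\alpha)$, and let $C^*_r(\mathcal{G})$ be the completion of the convolution $*$-algebra $C_c(\mathcal{G})$ in the norm $\|f\|_r=\sup_{x\in\mathcal{G}^{(0)}}\|\lambda_x(f)\|$; each $\lambda_x$ extends to $C^*_r(\mathcal{G})$. Let $E:C^*_r(\mathcal{G})\to C_0(\mathcal{G}^{(0)})$, $E(a)(u)=\langle\lambda_u(a)\delta_u,\delta_u\rangle$, be the canonical conditional expectation. Let $\mu$ be a Radon probability measure on $\mathcal{G}^{(0)}$ that is invariant: for every open bisection $B\subseteq\mathcal{G}$ one has $(\alpha_B)_*(\mu|_{\mathrm{s}(B)})=\mu|_{\mathrm{r}(B)}$,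 where $\alpha_B=\mathrm{r}\circ(\mathrm{s}|_B)^{-1}:\mathrm{s}(B)\to\mathrm{r}(B)$. Put $\tau_\mu(a)=\int_{\mathcal{G}^{(0)}}E(a)\,d\mu$ and $I_\mu=\{a\in C^*_r(\mathcal{G}):\tau_\mu(a^*a)=0\}$. The support $\mathrm{supp}\,\mu$ is a closed invariant subset of $\mathcal{G}^{(0)}$; let $\mathcal{G}_{\mathrm{supp}\mu}=\mathrm{s}^{-1}(\mathrm{supp}\,\mu)$, again a locally compact Hausdorff étale groupoid. Then $I_\mu$ is a closed two-sided ideal of $C^*_r(\mathcal{G})$, and the restriction map $C_c(\mathcal{G})\to C_c(\mathcal{G}_{\mathrm{supp}\mu})$ extends to a $*$-homomorphism $\pi:C^*_r(\mathcal{G})\to C^*_r(\mathcal{G}_{\mathrm{supp}\mu})$ such that, with the inclusion $I_\mu\hookrightarrow C^*_r(\mathcal{G})$, \[ 0\longrightarrow I_\mu\longrightarrow C^*_r(\mathcal{G})\xrightarrow{\ \pi\ }C^*_r(\mathcal{G}_{\mathrm{supp}\mu})\longrightarrow 0 \] is a short exact sequence. -/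

import Mathlib

open MeasureTheory Topology Filter
open scoped CompactlySupported ENNReal ZeroAtInfty

universe u

namespace GroupoidCStar

/-! ### Groupoids and étale groupoids -/

/-- A groupoid, presented by its set `G` of arrows: a unit space `units ⊆ G`, source and range maps
`src, rng : G → units`, a multiplication defined exactly on the composable pairs
(those with `src a = rng b`) and an inversion. -/
class GroupoidOn (G : Type u) where
  units : Set G
  src : G → units
  rng : G → units
  mul : (a b : G) → src a = rng b → G
  inv : G → G
  src_unit : ∀ x : units, src (x : G) = x
  rng_unit : ∀ x : units, rng (x : G) = x
  src_mul : ∀ (a b : G) (h : src a = rng b), src (mul a b h) = src b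
  rng_mul : ∀ (a b : G) (h : src a = rng b), rng (mul a b h) = rng a
  mul_assoc : ∀ (a b c : G) (h : src a = rng b) (h' : src b = rng c),
    mul (mul a b h) c ((src_mul a b h).trans h') = mul a (mul b c h') (h.trans (rng_mul b c h').symm)
  mul_unit : ∀ a : G, mul a (src a) (rng_unit (src a)).symm = a
  unit_mul : ∀ a : G, mul (rng a) a (src_unit (rng a)) = a
  src_inv : ∀ a : G, src (inv a) = rng a
  rng_inv : ∀ a : G, rng (inv a) = src a
  inv_mul : ∀ a : G, mul (inv a) a (src_inv a) = src a
  mul_inv : ∀ a : G, mul a (inv a) (rng_inv a).symm = rng a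

open GroupoidOn

/-- The unit space `G⁽⁰⁾` of a groupoid (with the subspace topology when `G` has one). -/
abbrev UnitSpace (G : Type u) [GroupoidOn G] : Type u := (units : Set G)

/-- A topological groupoid: source, range, inversion and composition are continuous. -/
class IsTopGroupoid (G : Type u) [TopologicalSpace G] [GroupoidOn G] : Prop where
  continuous_src : Continuous (src : G → UnitSpace G)
  continuous_rng : Continuous (rng : G → UnitSpace G)
  continuous_inv : Continuous (inv : G → G)
  continuous_mul :
    Continuous fun p : {p : G × G // src p.1 = rng p.2} => mul p.1.1 p.1.2 p.2

/-- An étale groupoid: a topological groupoid whose range map is a local homeomorphism onto the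
unit space. -/
class IsEtale (G : Type u) [TopologicalSpace G] [GroupoidOn G] : Prop extends IsTopGroupoid G where
  isLocalHomeomorph_rng : IsLocalHomeomorph (rng : G → UnitSpace G)

section algebra

variable {G : Type u} [GroupoidOn G]

theorem mul_congr {a a' b b' : G} (h : src a = rng b) (ha : a = a') (hb : b = b') :
    mul a b h = mul a' b' (by subst ha hb; exact h) := by
  subst ha hb; rfl

theorem inv_mul_cancel_left (a b : G) (h : src a = rng b) :
    mul (inv a) (mul a b h) ((src_inv a).trans (rng_mul a b h).symm) = b := by
  rw [← mul_assoc (inv a) a b (src_inv a) h, mul_congr _ (inv_mul a) rfl]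
  refine Eq.trans ?_ (unit_mul b)
  exact mul_congr _ (congrArg Subtype.val h) rfl

theorem mul_inv_cancel_right (a b : G) (h : src a = rng b) :
    mul (mul a b h) (inv b) ((src_mul a b h).trans (rng_inv b).symm) = a := by
  rw [mul_assoc a b (inv b) h (rng_inv b).symm, mul_congr _ rfl (mul_inv b)]
  refine Eq.trans ?_ (mul_unit a)
  exact mul_congr _ rfl (congrArg Subtype.val h.symm)

theorem inv_unique (a b : G) (h : src a = rng b) (hm : mul a b h = rng a) : b = inv a := by
  have h1 := inv_mul_cancel_left a b h
  rw [mul_congr _ rfl hm] at h1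
  rw [← h1]
  refine Eq.trans ?_ (mul_unit (inv a))
  exact mul_congr _ rfl (congrArg Subtype.val (src_inv a).symm)

theorem inv_inv (a : G) : inv (inv a) = a := by
  refine (inv_unique (inv a) a (src_inv a) ?_).symm
  rw [inv_mul, rng_inv]

theorem inv_unit (x : UnitSpace G) : inv (x : G) = x := by
  refine (inv_unique (x : G) x ((src_unit x).trans (rng_unit x).symm) ?_).symm
  refine (mul_congr _ rfl (congrArg Subtype.val (src_unit x).symm)).trans ?_
  rw [mul_unit, rng_unit]

/-- The product `γ α⁻¹` of two arrows with the same source. -/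
def divR (γ α : G) (h : src γ = src α) : G := mul γ (inv α) (h.trans (rng_inv α).symm)

theorem src_divR (γ α : G) (h : src γ = src α) : src (divR γ α h) = rng α :=
  (src_mul _ _ _).trans (src_inv α)

theorem rng_divR (γ α : G) (h : src γ = src α) : rng (divR γ α h) = rng γ := rng_mul _ _ _

theorem divR_congr {a a' b b' : G} (h : src a = src b) (ha : a = a') (hb : b = b') :
    divR a b h = divR a' b' (by subst ha hb; exact h) := by
  subst ha hb; rfl

theorem divR_mul (γ α : G) (h : src γ = src α) :
    mul (divR γ α h) α (src_divR γ α h) = γ := by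
  have := mul_inv_cancel_right γ (inv α) (h.trans (rng_inv α).symm)
  rwa [mul_congr _ rfl (inv_inv α)] at this

theorem mul_divR (a b : G) (h : src a = rng b) : divR (mul a b h) b (src_mul a b h) = a :=
  mul_inv_cancel_right a b h

theorem divR_inj_left {γ γ' α : G} (h : src γ = src α) (h' : src γ' = src α)
    (e : divR γ α h = divR γ' α h') : γ = γ' := by
  rw [← divR_mul γ α h, ← divR_mul γ' α h']
  exact mul_congr _ e rfl

theorem divR_inj_right {γ α α' : G} (h : src γ = src α) (h' : src γ = src α')
    (e : divR γ α h = divR γ α' h') : α = α' := by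
  have h1 := inv_mul_cancel_left γ (inv α) (h.trans (rng_inv α).symm)
  have h2 := inv_mul_cancel_left γ (inv α') (h'.trans (rng_inv α').symm)
  have : inv α = inv α' := by
    rw [← h1, ← h2]
    exact mul_congr _ rfl e
  rw [← inv_inv α, this, inv_inv]

theorem inv_divR (γ α : G) (h : src γ = src α) : inv (divR γ α h) = divR α γ h.symm := by
  refine (inv_unique (divR γ α h) (divR α γ h.symm) ?_ ?_).symm
  · rw [src_divR, rng_divR]
  · have h1 := mul_assoc (divR γ α h) α (inv γ) (src_divR γ α h) (h.symm.trans (rng_inv γ).symm)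
    refine h1.symm.trans ?_
    rw [mul_congr _ (divR_mul γ α h) rfl, GroupoidOn.mul_inv, rng_divR]

theorem divR_divR (γ α β : G) (h : src γ = src α) (h' : src β = src α) :
    divR (divR γ α h) (divR β α h') (by rw [src_divR, src_divR]) = divR γ β (h.trans h'.symm) := by
  have e : inv (divR β α h') = divR α β h'.symm := inv_divR β α h'
  have h3 : src (divR γ α h) = rng (divR α β h'.symm) := by rw [src_divR, rng_divR]
  have h1 := GroupoidOn.mul_assoc (divR γ α h) α (inv β) (src_divR γ α h)
    (h'.symm.trans (rng_inv β).symm)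
  calc divR (divR γ α h) (divR β α h') _ = mul (divR γ α h) (divR α β h'.symm) h3 :=
        mul_congr _ rfl e
    _ = _ := h1.symm
    _ = divR γ β (h.trans h'.symm) := mul_congr _ (divR_mul γ α h) rfl

theorem divR_unit (γ : G) : divR γ (src γ : G) (src_unit (src γ)).symm = γ := by
  unfold divR
  rw [mul_congr _ rfl (inv_unit (src γ)), mul_unit]

/-- The source fibre `G_x`. -/
abbrev Fiber (x : UnitSpace G) : Type u := {γ : G // src γ = x}

theorem Fiber.src_eq {x : UnitSpace G} (γ α : Fiber x) : src γ.1 = src α.1 := γ.2.trans α.2.symm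

/-- The unit `x`, as a point of the fibre `G_x`. -/
def Fiber.unit (x : UnitSpace G) : Fiber x := ⟨(x : G), src_unit x⟩

end algebra

/-! ### Matrices with uniformly finite rows and columns as operators on `ℓ²` -/

section matrixOperator

variable {ι : Type u}

/-- The Hilbert space `ℓ²(ι)`. -/
abbrev Ell2 (ι : Type u) : Type u := lp (fun _ : ι => ℂ) 2

/-- A matrix with entries bounded by `C` and with at most `N` nonzero entries in each row and in
each column. -/
structure IsBoundedMatrix (k : ι → ι → ℂ) (N : ℕ) (C : ℝ) : Prop where
  norm_le : ∀ i j, ‖k i j‖ ≤ C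
  row : ∀ i, ∀ S : Finset ι, (∀ j ∈ S, k i j ≠ 0) → S.card ≤ N
  col : ∀ j, ∀ S : Finset ι, (∀ i ∈ S, k i j ≠ 0) → S.card ≤ N

theorem finite_of_card_le {s : Set ι} {N : ℕ} (h : ∀ S : Finset ι, (∀ j ∈ S, j ∈ s) → S.card ≤ N) :
    s.Finite := by
  by_contra hs
  obtain ⟨t, ht, hc⟩ := Set.Infinite.exists_subset_card_eq hs (N + 1)
  have := h t (fun j hj => ht hj)
  omega

theorem IsBoundedMatrix.row_finite {k : ι → ι → ℂ} {N : ℕ} {C : ℝ} (h : IsBoundedMatrix k N C)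
    (i : ι) : {j | k i j ≠ 0}.Finite :=
  finite_of_card_le (h.row i)

theorem IsBoundedMatrix.summable {k : ι → ι → ℂ} {N : ℕ} {C : ℝ} (h : IsBoundedMatrix k N C)
    (i : ι) (ξ : ι → ℂ) : Summable fun j => k i j * ξ j := by
  refine summable_of_ne_finset_zero (s := (h.row_finite i).toFinset) fun j hj => ?_
  have : k i j = 0 := by simpa using hj
  simp [this]

theorem IsBoundedMatrix.sum_le {k : ι → ι → ℂ} {N : ℕ} {C : ℝ} (h : IsBoundedMatrix k N C)
    (ξ : Ell2 ι) (S : Finset ι) :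
    ∑ i ∈ S, ‖∑' j, k i j * ξ j‖ ^ 2 ≤ (N * C * ‖ξ‖) ^ 2 := by
  classical
  have hC : ∀ i : ι, 0 ≤ C := fun i => (norm_nonneg _).trans (h.norm_le i i)
  let R : ι → Finset ι := fun i => (h.row_finite i).toFinset
  have hR : ∀ i j, j ∈ R i ↔ k i j ≠ 0 := fun i j => by simp [R]
  have h1 : ∀ i ∈ S, ‖∑' j, k i j * ξ j‖ ^ 2 ≤ N * C ^ 2 * ∑ j ∈ R i, ‖ξ j‖ ^ 2 := by
    intro i _
    rw [tsum_eq_sum (s := R i) (fun j hj => by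
      have : k i j = 0 := by simpa [hR] using hj
      simp [this])]
    calc ‖∑ j ∈ R i, k i j * ξ j‖ ^ 2 ≤ (∑ j ∈ R i, C * ‖ξ j‖) ^ 2 := by
          gcongr
          refine (norm_sum_le _ _).trans (Finset.sum_le_sum fun j _ => ?_)
          rw [norm_mul]
          gcongr
          exact h.norm_le i j
      _ ≤ (R i).card * ∑ j ∈ R i, (C * ‖ξ j‖) ^ 2 := sq_sum_le_card_mul_sum_sq
      _ ≤ N * ∑ j ∈ R i, (C * ‖ξ j‖) ^ 2 := by
          gcongr
          exact h.row i _ (fun j hj => (hR i j).1 hj)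
      _ = N * C ^ 2 * ∑ j ∈ R i, ‖ξ j‖ ^ 2 := by
          simp_rw [mul_pow, ← Finset.mul_sum]; ring
  have h2 : ∑ i ∈ S, ∑ j ∈ R i, ‖ξ j‖ ^ 2 ≤ N * ‖ξ‖ ^ 2 := by
    rw [Finset.sum_comm' (t' := S.biUnion R) (s' := fun j => S.filter fun i => j ∈ R i)]
    · calc ∑ j ∈ S.biUnion R, ∑ i ∈ S.filter (fun i => j ∈ R i), ‖ξ j‖ ^ 2
          ≤ ∑ j ∈ S.biUnion R, N * ‖ξ j‖ ^ 2 := by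
            refine Finset.sum_le_sum fun j _ => ?_
            rw [Finset.sum_const, nsmul_eq_mul]
            gcongr
            refine h.col j _ fun i hi => ?_
            exact (hR i j).1 (Finset.mem_filter.1 hi).2
        _ ≤ N * ‖ξ‖ ^ 2 := by
            rw [← Finset.mul_sum]
            gcongr
            simpa using lp.sum_rpow_le_norm_rpow (p := 2) (by simp) ξ (S.biUnion R)
    · intro i j
      simp only [Finset.mem_filter, Finset.mem_biUnion]
      exact ⟨fun h => ⟨⟨h.1, h.2⟩, i, h.1, h.2⟩, fun h => h.1⟩
  calc ∑ i ∈ S, ‖∑' j, k i j * ξ j‖ ^ 2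
      ≤ ∑ i ∈ S, N * C ^ 2 * ∑ j ∈ R i, ‖ξ j‖ ^ 2 := Finset.sum_le_sum h1
    _ = N * C ^ 2 * ∑ i ∈ S, ∑ j ∈ R i, ‖ξ j‖ ^ 2 := by rw [Finset.mul_sum]
    _ ≤ N * C ^ 2 * (N * ‖ξ‖ ^ 2) := by gcongr
    _ = (N * C * ‖ξ‖) ^ 2 := by ring

/-- The bounded operator on `ℓ²(ι)` given by a matrix: `(k ξ)(i) = ∑ j, k i j ξ(j)`. -/
noncomputable def matrixOp (k : ι → ι → ℂ) {N : ℕ} {C : ℝ} (h : IsBoundedMatrix k N C) :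
    Ell2 ι →L[ℂ] Ell2 ι :=
  LinearMap.mkContinuousOfExistsBound
    { toFun := fun ξ => ⟨fun i => ∑' j, k i j * ξ j, by
        refine memℓp_gen' (C := (N * C * ‖ξ‖) ^ 2) fun S => ?_
        simpa using h.sum_le ξ S⟩
      map_add' := fun ξ η => by
        ext i
        simp only [lp.coeFn_add, Pi.add_apply, mul_add]
        exact (h.summable i ξ).tsum_add (h.summable i η)
      map_smul' := fun c ξ => by
        ext i
        simp only [lp.coeFn_smul, Pi.smul_apply, smul_eq_mul, RingHom.id_apply]
        rw [← tsum_mul_left]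
        exact tsum_congr fun j => by ring }
    ⟨N * |C|, fun ξ => by
      refine lp.norm_le_of_forall_sum_le (by simp) (by positivity) fun S => ?_
      have := h.sum_le ξ S
      simp only [ENNReal.toReal_ofNat, Real.rpow_ofNat]
      refine this.trans ?_
      rw [mul_pow, mul_pow, mul_pow, mul_pow, sq_abs]⟩

theorem matrixOp_apply {k : ι → ι → ℂ} {N : ℕ} {C : ℝ} (h : IsBoundedMatrix k N C) (ξ : Ell2 ι)
    (i : ι) : matrixOp k h ξ i = ∑' j, k i j * ξ j := rfl

theorem matrixOp_norm_le {k : ι → ι → ℂ} {N : ℕ} {C : ℝ} (h : IsBoundedMatrix k N C) (hC : 0 ≤ C) :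
    ‖matrixOp k h‖ ≤ N * C := by
  refine ContinuousLinearMap.opNorm_le_bound _ (by positivity) fun ξ => ?_
  refine lp.norm_le_of_forall_sum_le (by simp) (by positivity) fun S => ?_
  simpa [matrixOp_apply] using h.sum_le ξ S

/-- The basis vector `δ_i` of `ℓ²(ι)`. -/
noncomputable def delta (i : ι) : Ell2 ι := by
  classical exact lp.single 2 i (1 : ℂ)

theorem norm_delta (i : ι) : ‖(delta i : Ell2 ι)‖ = 1 := by
  classical
  unfold delta
  refine (lp.norm_single (E := fun _ : ι => ℂ) (p := 2) (by norm_num) i (1 : ℂ)).trans ?_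
  simp

theorem inner_delta_left (i : ι) (ξ : Ell2 ι) : inner ℂ (delta i) ξ = ξ i := by
  classical
  have := lp.inner_single_left (𝕜 := ℂ) (G := fun _ : ι => ℂ) i (1 : ℂ) ξ
  unfold delta
  convert this using 1
  simp

theorem matrixOp_delta {k : ι → ι → ℂ} {N : ℕ} {C : ℝ} (h : IsBoundedMatrix k N C) (i j : ι) :
    matrixOp k h (delta j) i = k i j := by
  classical
  rw [matrixOp_apply, tsum_eq_single j]
  · simp [delta]
  · intro l hl
    have : (delta j : Ell2 ι) l = 0 := by
      unfold delta
      exact lp.single_apply_ne (E := fun _ : ι => ℂ) 2 j (1 : ℂ) hl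
    rw [this, mul_zero]

theorem ext_delta {A B : Ell2 ι →L[ℂ] Ell2 ι} (h : ∀ i j, A (delta j) i = B (delta j) i) :
    A = B := by
  classical
  have key : ∀ j, A (delta j) = B (delta j) := fun j => by
    ext i; exact h i j
  ext1 ξ
  have hs := lp.hasSum_single (p := 2) (by simp) ξ
  have e : ∀ j, lp.single 2 j (ξ j) = ξ j • (delta j : Ell2 ι) := fun j => by
    unfold delta
    rw [← lp.single_smul]; simp
  have hA := (A.hasSum hs)
  have hB := (B.hasSum hs)
  refine hA.unique ?_
  convert hB using 2 with j
  rw [e, map_smul, map_smul, key]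

end matrixOperator

/-! ### Topology of étale groupoids -/

section topology

open IsTopGroupoid

variable {G : Type u} [TopologicalSpace G] [GroupoidOn G]

/-- Inversion as a homeomorphism. -/
def invHomeo (G : Type u) [TopologicalSpace G] [GroupoidOn G] [IsTopGroupoid G] : G ≃ₜ G where
  toFun := inv
  invFun := inv
  left_inv := inv_inv
  right_inv := inv_inv
  continuous_toFun := continuous_inv
  continuous_invFun := continuous_inv

theorem isLocalHomeomorph_src [IsEtale G] : IsLocalHomeomorph (src : G → UnitSpace G) := by
  have h := (IsEtale.isLocalHomeomorph_rng (G := G)).comp (invHomeo G).isLocalHomeomorph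
  have e : (rng : G → UnitSpace G) ∘ (invHomeo G) = src := funext fun a => rng_inv a
  rwa [e] at h

theorem exists_card_le_of_isLocalHomeomorph {X Y : Type u} [TopologicalSpace X]
    [TopologicalSpace Y] {p : X → Y} (hp : IsLocalHomeomorph p) {K : Set X} (hK : IsCompact K) :
    ∃ N : ℕ, ∀ (y : Y) (S : Finset X), (∀ a ∈ S, a ∈ K ∧ p a = y) → S.card ≤ N := by
  classical
  choose e he hpe using hp
  obtain ⟨t, -, ht⟩ := hK.elim_nhds_subcover (fun a => (e a).source)
    (fun a _ => (e a).open_source.mem_nhds (he a))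
  refine ⟨t.card, fun y S hS => ?_⟩
  have hc : ∀ a ∈ S, ∃ i ∈ t, a ∈ (e i).source := fun a ha => by
    have := ht (hS a ha).1
    simpa using this
  choose! c hct hca using hc
  refine Finset.card_le_card_of_injOn c hct fun a ha b hb hab => ?_
  have ha' := hca a ha
  have hb' := hca b hb
  rw [← hab] at hb'
  refine (e (c a)).injOn ha' hb' ?_
  rw [← hpe, (hS a ha).2, (hS b hb).2]

theorem exists_card_le [IsEtale G] {K : Set G} (hK : IsCompact K) :
    ∃ N : ℕ, (∀ (y : UnitSpace G) (S : Finset G), (∀ a ∈ S, a ∈ K ∧ src a = y) → S.card ≤ N) ∧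
      ∀ (y : UnitSpace G) (S : Finset G), (∀ a ∈ S, a ∈ K ∧ rng a = y) → S.card ≤ N := by
  obtain ⟨N, hN⟩ := exists_card_le_of_isLocalHomeomorph (isLocalHomeomorph_src (G := G)) hK
  obtain ⟨M, hM⟩ := exists_card_le_of_isLocalHomeomorph
    (IsEtale.isLocalHomeomorph_rng (G := G)) hK
  exact ⟨max N M, fun y S hS => (hN y S hS).trans (le_max_left _ _),
    fun y S hS => (hM y S hS).trans (le_max_right _ _)⟩

theorem exists_norm_le {X : Type u} [TopologicalSpace X] (f : C_c(X, ℂ)) :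
    ∃ C : ℝ, 0 ≤ C ∧ ∀ a, ‖f a‖ ≤ C := by
  obtain ⟨C, hC⟩ := f.hasCompactSupport.exists_bound_of_continuous f.continuous
  exact ⟨max C 0, le_max_right _ _, fun a => (hC a).trans (le_max_left _ _)⟩

end topology

/-! ### The regular representations -/

section fiberOps

variable {G : Type u} [GroupoidOn G]

/-- The C⋆-algebra `∏_x B(ℓ²(G_x))` of uniformly bounded families of operators, with the
supremum norm. -/
def FiberOps (G : Type u) [GroupoidOn G] : Type u :=
  ↥(lp (fun x : UnitSpace G => Ell2 (Fiber x) →L[ℂ] Ell2 (Fiber x)) ∞)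

noncomputable instance : NonUnitalCStarAlgebra (FiberOps G) :=
  inferInstanceAs (NonUnitalCStarAlgebra
    ↥(lp (fun x : UnitSpace G => Ell2 (Fiber x) →L[ℂ] Ell2 (Fiber x)) ∞))

/-- The component at `x` of a family of operators. -/
def FiberOps.component (T : FiberOps G) (x : UnitSpace G) : Ell2 (Fiber x) →L[ℂ] Ell2 (Fiber x) := T.1 x

theorem FiberOps.ext {S T : FiberOps G} (h : ∀ x, S.component x = T.component x) : S = T := lp.ext (funext h)

theorem FiberOps.norm_component_le (T : FiberOps G) (x : UnitSpace G) : ‖T.component x‖ ≤ ‖T‖ :=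
  lp.norm_apply_le_norm ENNReal.top_ne_zero
    (show lp (fun x : UnitSpace G => Ell2 (Fiber x) →L[ℂ] Ell2 (Fiber x)) ∞ from T) x

end fiberOps

section regularRepresentation

variable {G : Type u} [TopologicalSpace G] [GroupoidOn G]

/-- The matrix `(γ, α) ↦ f(γ α⁻¹)` of the left regular representation on `ℓ²(G_x)`. -/
def regMatrix (f : G → ℂ) (x : UnitSpace G) : Fiber x → Fiber x → ℂ :=
  fun γ α => f (divR γ.1 α.1 (γ.src_eq α))

theorem exists_isBoundedMatrix [IsEtale G] (f : C_c(G, ℂ)) :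
    ∃ NC : ℕ × ℝ, 0 ≤ NC.2 ∧ ∀ x : UnitSpace G, IsBoundedMatrix (regMatrix f x) NC.1 NC.2 := by
  classical
  obtain ⟨C, hC0, hC⟩ := exists_norm_le f
  obtain ⟨N, hN, hN'⟩ := exists_card_le (G := G) f.hasCompactSupport.isCompact
  refine ⟨(N, C), hC0, fun x => ⟨fun i j => hC _, fun γ S hS => ?_, fun α S hS => ?_⟩⟩
  · have hinj : Function.Injective fun α : Fiber x => divR γ.1 α.1 (γ.src_eq α) :=
      fun α β h => Subtype.ext (divR_inj_right _ _ h)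
    rw [← Finset.card_image_of_injective S hinj]
    refine hN' (rng γ.1) _ fun a ha => ?_
    obtain ⟨α, hα, rfl⟩ := Finset.mem_image.1 ha
    exact ⟨subset_tsupport _ (hS α hα), rng_divR _ _ _⟩
  · have hinj : Function.Injective fun γ : Fiber x => divR γ.1 α.1 (γ.src_eq α) :=
      fun γ β h => Subtype.ext (divR_inj_left _ _ h)
    rw [← Finset.card_image_of_injective S hinj]
    refine hN (rng α.1) _ fun a ha => ?_
    obtain ⟨γ, hγ, rfl⟩ := Finset.mem_image.1 ha
    exact ⟨subset_tsupport _ (hS γ hγ), src_divR _ _ _⟩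

/-- The left regular representation at `x`:
`(λ_x(f) ξ)(γ) = ∑_{α ∈ G_x} f(γ α⁻¹) ξ(α)` on `ℓ²(G_x)`. -/
noncomputable def leftReg [IsEtale G] (x : UnitSpace G) (f : C_c(G, ℂ)) :
    Ell2 (Fiber x) →L[ℂ] Ell2 (Fiber x) :=
  matrixOp (regMatrix f x) ((exists_isBoundedMatrix f).choose_spec.2 x)

theorem leftReg_apply [IsEtale G] (x : UnitSpace G) (f : C_c(G, ℂ)) (ξ : Ell2 (Fiber x))
    (γ : Fiber x) :
    leftReg x f ξ γ = ∑' α : Fiber x, f (divR γ.1 α.1 (γ.src_eq α)) * ξ α := rfl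

theorem leftReg_delta [IsEtale G] (x : UnitSpace G) (f : C_c(G, ℂ)) (γ α : Fiber x) :
    leftReg x f (delta α) γ = f (divR γ.1 α.1 (γ.src_eq α)) := matrixOp_delta _ _ _

/-- The family `(λ_x(f))_x`; its norm is the reduced norm `sup_x ‖λ_x(f)‖` of `f`. -/
noncomputable def regRep (G : Type u) [TopologicalSpace G] [GroupoidOn G] [IsEtale G] :
    C_c(G, ℂ) →ₗ[ℂ] FiberOps G where
  toFun f := ⟨fun x => leftReg x f, memℓp_infty ⟨(exists_isBoundedMatrix f).choose.1 *
    (exists_isBoundedMatrix f).choose.2, by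
      rintro _ ⟨x, rfl⟩
      exact matrixOp_norm_le _ (exists_isBoundedMatrix f).choose_spec.1⟩⟩
  map_add' f g := by
    refine FiberOps.ext fun x => ext_delta fun γ α => ?_
    change leftReg x (f + g) (delta α) γ = (leftReg x f (delta α) + leftReg x g (delta α)) γ
    simp [leftReg_delta]
  map_smul' c f := by
    refine FiberOps.ext fun x => ext_delta fun γ α => ?_
    change leftReg x (c • f) (delta α) γ = (c • leftReg x f (delta α)) γ
    simp [leftReg_delta]

theorem regRep_apply [IsEtale G] (f : C_c(G, ℂ)) (x : UnitSpace G) :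
    (regRep G f).component x = leftReg x f := rfl

end regularRepresentation

/-! ### The convolution algebra `C_c(G)` -/

section convolution

open IsTopGroupoid

variable {G : Type u} [TopologicalSpace G] [GroupoidOn G]

/-- Convolution: `(f * g)(γ) = ∑_{α ∈ G_{s(γ)}} f(γ α⁻¹) g(α)`. -/
noncomputable def convFun (f g : G → ℂ) (γ : G) : ℂ :=
  ∑' α : Fiber (src γ), f (divR γ α.1 α.2.symm) * g α.1

theorem finite_fiber_support [IsEtale G] (g : C_c(G, ℂ)) (x : UnitSpace G) :
    {α : Fiber x | g α.1 ≠ 0}.Finite := by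
  classical
  obtain ⟨N, hN, -⟩ := exists_card_le (G := G) g.hasCompactSupport.isCompact
  refine finite_of_card_le (N := N) fun S hS => ?_
  rw [← Finset.card_image_of_injective S Subtype.val_injective]
  refine hN x _ fun a ha => ?_
  obtain ⟨α, hα, rfl⟩ := Finset.mem_image.1 ha
  exact ⟨subset_tsupport _ (hS α hα), α.2⟩

theorem summable_conv [IsEtale G] (f : G → ℂ) (g : C_c(G, ℂ)) (γ : G) :
    Summable fun α : Fiber (src γ) => f (divR γ α.1 α.2.symm) * g α.1 := by
  refine summable_of_ne_finset_zero (s := (finite_fiber_support g (src γ)).toFinset) fun j hj => ?_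
  have : g j.1 = 0 := by simpa using hj
  simp [this]

theorem convFun_sum [IsEtale G] {n : ℕ} (f : G → ℂ) (g : Fin n → C_c(G, ℂ)) (γ : G) :
    convFun f (fun a => ∑ i, g i a) γ = ∑ i, convFun f (g i) γ := by
  unfold convFun
  rw [← Summable.tsum_finsetSum fun i _ => summable_conv f (g i) γ]
  exact tsum_congr fun α => by rw [Finset.mul_sum]

theorem continuous_convFun_of_subset [T2Space G] [IsEtale G] {f g : G → ℂ} (hf : Continuous f)
    (hg : Continuous g) (hgc : HasCompactSupport g) (e : OpenPartialHomeomorph G (UnitSpace G))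
    (he : (src : G → UnitSpace G) = e) (hs : tsupport g ⊆ e.source) :
    Continuous (convFun f g) := by
  have hsrc : Continuous (src : G → UnitSpace G) := continuous_src
  -- on the saturation of the section the sum has exactly one possibly nonzero term
  have hval : ∀ γ : G, ∀ h : src γ ∈ e.target, ∀ hh : src γ = src (e.symm (src γ)),
      convFun f g γ = f (divR γ (e.symm (src γ)) hh) * g (e.symm (src γ)) := by
    intro γ h hh
    unfold convFun
    rw [tsum_eq_single (⟨e.symm (src γ), hh.symm⟩ : Fiber (src γ))]
    intro α hα
    by_cases hgα : g α.1 = 0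
    · simp [hgα]
    · exfalso
      apply hα
      apply Subtype.ext
      have h1 : α.1 ∈ e.source := hs (subset_tsupport _ hgα)
      rw [← e.left_inv h1, ← he, α.2]
  rw [continuous_iff_continuousAt]
  intro γ
  by_cases hγ : src γ ∈ src '' (tsupport g)
  · have hopen : IsOpen ((src : G → UnitSpace G) ⁻¹' e.target) := e.open_target.preimage hsrc
    have hmem : γ ∈ (src : G → UnitSpace G) ⁻¹' e.target := by
      obtain ⟨α, hα, hαγ⟩ := hγ
      change src γ ∈ e.target
      rw [← hαγ, he]
      exact e.map_source (hs hα)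
    refine ContinuousOn.continuousAt ?_ (hopen.mem_nhds hmem)
    rw [continuousOn_iff_continuous_domRestrict]
    have hsec : ∀ y ∈ e.target, src (e.symm y) = y := fun y hy => by
      rw [he]; exact e.right_inv hy
    have hcs : Continuous fun v : ((src : G → UnitSpace G) ⁻¹' e.target) => e.symm (src v.1) :=
      e.continuousOn_symm.comp_continuous (hsrc.comp continuous_subtype_val) fun v => v.2
    have hd : Continuous fun v : ((src : G → UnitSpace G) ⁻¹' e.target) =>
        divR v.1 (e.symm (src v.1)) (hsec _ v.2).symm := by
      unfold divR
      exact continuous_mul.comp (Continuous.subtype_mk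
        (continuous_subtype_val.prodMk (IsTopGroupoid.continuous_inv.comp hcs))
        fun v => (hsec _ v.2).symm.trans (rng_inv _).symm)
    refine ((hf.comp hd).mul (hg.comp hcs)).congr fun v => ?_
    exact (hval v.1 v.2 (hsec _ v.2).symm).symm
  · have hcl : IsClosed (src '' (tsupport g) : Set (UnitSpace G)) :=
      (hgc.isCompact.image hsrc).isClosed
    have hev : ∀ᶠ γ' in 𝓝 γ, convFun f g γ' = 0 := by
      filter_upwards [(hcl.isOpen_compl.preimage hsrc).mem_nhds hγ] with γ' hγ'
      refine (tsum_congr fun α => ?_).trans tsum_zero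
      by_cases hgα : g α.1 = 0
      · simp [hgα]
      · exact absurd ⟨α.1, subset_tsupport _ hgα, α.2⟩ hγ'
    exact (continuousAt_const (y := (0 : ℂ))).congr (hev.mono fun _ h => h.symm)

theorem exists_decomposition [T2Space G] [LocallyCompactSpace G] [IsEtale G] (g : C_c(G, ℂ)) :
    ∃ (n : ℕ) (gi : Fin n → C_c(G, ℂ)), (∀ a, g a = ∑ i, gi i a) ∧
      ∀ i, ∃ e : OpenPartialHomeomorph G (UnitSpace G), (src : G → UnitSpace G) = e ∧
        tsupport (gi i) ⊆ e.source := by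
  classical
  choose e he hpe using isLocalHomeomorph_src (G := G)
  obtain ⟨t, ht⟩ := g.hasCompactSupport.isCompact.elim_nhds_subcover
    (fun a => (e a).source) (fun a _ => (e a).open_source.mem_nhds (he a))
  obtain ⟨φ, hφs, hφ1, -, hφc⟩ := exists_continuous_sum_one_of_isOpen_isCompact
    (s := fun i : Fin t.card => (e (t.equivFin.symm i).1).source)
    (fun i => (e _).open_source) g.hasCompactSupport.isCompact (by
      intro a ha
      obtain ⟨b, hb, hab⟩ := Set.mem_iUnion₂.1 (ht.2 ha)
      refine Set.mem_iUnion.2 ⟨t.equivFin ⟨b, hb⟩, ?_⟩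
      simpa using hab)
  have hsupp : ∀ i, tsupport (fun a => ((φ i a : ℝ) : ℂ) * g a) ⊆ tsupport (φ i) := fun i =>
    closure_mono fun a ha hz => ha (by simp [hz])
  refine ⟨t.card, fun i => ⟨⟨fun a => ((φ i a : ℝ) : ℂ) * g a, by fun_prop⟩,
    (hφc i).mono' ?_⟩, fun a => ?_, fun i => ⟨e (t.equivFin.symm i).1, hpe _, ?_⟩⟩
  · exact subset_closure.trans (hsupp i)
  · change g a = ∑ i, ((φ i a : ℝ) : ℂ) * g a
    rw [← Finset.sum_mul]
    by_cases ha : g a = 0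
    · simp [ha]
    · have := hφ1 (subset_tsupport _ ha)
      simp only [Finset.sum_apply, Pi.one_apply] at this
      rw [← Complex.ofReal_sum, this]
      simp
  · exact (hsupp i).trans (hφs i)

theorem continuous_convFun [T2Space G] [LocallyCompactSpace G] [IsEtale G] (f g : C_c(G, ℂ)) :
    Continuous (convFun f g) := by
  obtain ⟨n, gi, hsum, hgi⟩ := exists_decomposition g
  have e : convFun f g = fun γ => ∑ i, convFun f (gi i) γ := by
    funext γ
    rw [← convFun_sum]
    congr 1
    exact funext hsum
  rw [e]
  refine continuous_finsetSum _ fun i _ => ?_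
  obtain ⟨e, he, hs⟩ := hgi i
  exact continuous_convFun_of_subset f.continuous (gi i).continuous (gi i).hasCompactSupport e he hs

theorem hasCompactSupport_convFun [T2Space G] [IsEtale G] (f g : C_c(G, ℂ)) :
    HasCompactSupport (convFun f g) := by
  have hcl : IsClosed {p : G × G | src p.1 = rng p.2} :=
    isClosed_eq (continuous_src.comp continuous_fst) (continuous_rng.comp continuous_snd)
  have hK : IsCompact ((fun p : {p : G × G // src p.1 = rng p.2} => p.1) ⁻¹'
      (tsupport f ×ˢ tsupport g)) :=
    hcl.isClosedEmbedding_subtypeVal.isCompact_preimage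
      (f.hasCompactSupport.isCompact.prod g.hasCompactSupport.isCompact)
  refine HasCompactSupport.intro (hK.image continuous_mul) fun γ hγ => ?_
  refine (tsum_congr fun α => ?_).trans tsum_zero
  by_contra hne
  apply hγ
  have hf : f (divR γ α.1 α.2.symm) ≠ 0 := fun h => hne (by simp [h])
  have hg : g α.1 ≠ 0 := fun h => hne (by simp [h])
  exact ⟨⟨(divR γ α.1 α.2.symm, α.1), src_divR γ α.1 α.2.symm⟩,
    ⟨subset_tsupport _ hf, subset_tsupport _ hg⟩, divR_mul γ α.1 α.2.symm⟩

/-- The convolution product on `C_c(G)`. -/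
noncomputable def conv [T2Space G] [LocallyCompactSpace G] [IsEtale G] (f g : C_c(G, ℂ)) :
    C_c(G, ℂ) where
  toFun := convFun f g
  continuous_toFun := continuous_convFun f g
  hasCompactSupport' := hasCompactSupport_convFun f g

/-- The involution on `C_c(G)`: `f*(γ)` is the conjugate of `f(γ⁻¹)`. -/
noncomputable def involution [IsTopGroupoid G] (f : C_c(G, ℂ)) : C_c(G, ℂ) where
  toFun γ := star (f (inv γ))
  continuous_toFun := continuous_star.comp (f.continuous.comp continuous_inv)
  hasCompactSupport' :=
    (f.hasCompactSupport.comp_homeomorph (invHomeo G)).comp_left (g := (star : ℂ → ℂ)) (star_zero ℂ)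

theorem leftReg_conv [T2Space G] [LocallyCompactSpace G] [IsEtale G] (x : UnitSpace G)
    (f g : C_c(G, ℂ)) : leftReg x (conv f g) = leftReg x f * leftReg x g := by
  refine ext_delta fun γ α => ?_
  rw [leftReg_delta]
  change convFun f g _ = leftReg x f (leftReg x g (delta α)) γ
  rw [leftReg_apply]
  have hs : src (divR γ.1 α.1 (γ.src_eq α)) = rng α.1 := src_divR _ _ _
  let φ : Fiber x ≃ Fiber (src (divR γ.1 α.1 (γ.src_eq α))) :=
    { toFun := fun β => ⟨divR β.1 α.1 (β.src_eq α), (src_divR _ _ _).trans hs.symm⟩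
      invFun := fun δ => ⟨mul δ.1 α.1 (δ.2.trans hs), (src_mul _ _ _).trans α.2⟩
      left_inv := fun β => Subtype.ext (divR_mul β.1 α.1 (β.src_eq α))
      right_inv := fun δ => Subtype.ext (mul_divR δ.1 α.1 (δ.2.trans hs)) }
  unfold convFun
  rw [← φ.tsum_eq]
  refine tsum_congr fun β => ?_
  rw [leftReg_delta]
  congr 2
  exact divR_divR γ.1 α.1 β.1 (γ.src_eq α) (β.src_eq α)

theorem leftReg_involution [IsEtale G] (x : UnitSpace G) (f : C_c(G, ℂ)) :
    leftReg x (involution f) = star (leftReg x f) := by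
  refine ext_delta fun γ α => ?_
  rw [leftReg_delta, ← inner_delta_left, ContinuousLinearMap.star_eq_adjoint,
    ContinuousLinearMap.adjoint_inner_right, ← inner_conj_symm, inner_delta_left, leftReg_delta]
  change star (f (inv (divR γ.1 α.1 _))) = star _
  rw [inv_divR]

end convolution

/-! ### The reduced C⋆-algebra -/

section reduced

variable {G : Type u} [TopologicalSpace G] [GroupoidOn G] [T2Space G] [LocallyCompactSpace G]
  [IsEtale G]

/-- The image of `C_c(G)` in `∏_x B(ℓ²(G_x))`, a `*`-algebra since convolution and involution of
`C_c(G)` correspond to product and adjoint. -/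
noncomputable def ccImage (G : Type u) [TopologicalSpace G] [GroupoidOn G] [T2Space G]
    [LocallyCompactSpace G] [IsEtale G] : NonUnitalStarSubalgebra ℂ (FiberOps G) where
  carrier := Set.range (regRep G)
  add_mem' := by
    rintro _ _ ⟨f, rfl⟩ ⟨g, rfl⟩
    exact ⟨f + g, map_add _ _ _⟩
  zero_mem' := ⟨0, map_zero _⟩
  smul_mem' := by
    rintro c _ ⟨f, rfl⟩
    exact ⟨c • f, map_smul _ _ _⟩
  mul_mem' := by
    rintro _ _ ⟨f, rfl⟩ ⟨g, rfl⟩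
    refine ⟨conv f g, ?_⟩
    refine FiberOps.ext fun x => ?_
    exact leftReg_conv x f g
  star_mem' := by
    rintro _ ⟨f, rfl⟩
    refine ⟨involution f, ?_⟩
    refine FiberOps.ext fun x => ?_
    exact leftReg_involution x f

/-- The reduced groupoid C⋆-algebra `C*_r(G)`: the completion of `C_c(G)` in the reduced norm
`‖f‖_r = sup_x ‖λ_x(f)‖`, realised as the norm closure of `{(λ_x(f))_x : f ∈ C_c(G)}` in
`∏_x B(ℓ²(G_x))`. -/
noncomputable def reducedSubalgebra (G : Type u) [TopologicalSpace G] [GroupoidOn G] [T2Space G]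
    [LocallyCompactSpace G] [IsEtale G] : NonUnitalStarSubalgebra ℂ (FiberOps G) :=
  (ccImage G).topologicalClosure

/-- The reduced groupoid C⋆-algebra `C*_r(G)` as a type. -/
abbrev ReducedCStarAlgebra (G : Type u) [TopologicalSpace G] [GroupoidOn G] [T2Space G]
    [LocallyCompactSpace G] [IsEtale G] : Type u := reducedSubalgebra G

instance : IsClosed (reducedSubalgebra G : Set (FiberOps G)) :=
  (ccImage G).isClosed_topologicalClosure

/-- The canonical embedding `C_c(G) → C*_r(G)`. -/
noncomputable def ofCc (f : C_c(G, ℂ)) : ReducedCStarAlgebra G :=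
  ⟨regRep G f, (ccImage G).le_topologicalClosure ⟨f, rfl⟩⟩

theorem norm_ofCc (f : C_c(G, ℂ)) : ‖ofCc f‖ = ⨆ x : UnitSpace G, ‖leftReg x f‖ := rfl

theorem denseRange_ofCc : DenseRange (ofCc : C_c(G, ℂ) → ReducedCStarAlgebra G) := by
  intro a
  rw [Metric.mem_closure_iff]
  intro ε hε
  have ha : a.1 ∈ closure (Set.range (regRep G)) := a.2
  obtain ⟨_, ⟨f, rfl⟩, hf⟩ := Metric.mem_closure_iff.1 ha ε hε
  exact ⟨ofCc f, ⟨f, rfl⟩, hf⟩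

theorem ofCc_injective : Function.Injective (ofCc : C_c(G, ℂ) → ReducedCStarAlgebra G) := by
  intro f g h
  ext γ
  have h1 : leftReg (src γ) f = leftReg (src γ) g :=
    congrArg (fun a : ReducedCStarAlgebra G => a.1.component (src γ)) h
  have key : ∀ k : C_c(G, ℂ),
      leftReg (src γ) k (delta (Fiber.unit (src γ))) (⟨γ, rfl⟩ : Fiber (src γ)) = k γ := fun k =>
    (leftReg_delta (src γ) k ⟨γ, rfl⟩ (Fiber.unit (src γ))).trans (congrArg k (divR_unit γ))
  rw [← key f, h1, key g]

theorem ofCc_conv (f g : C_c(G, ℂ)) : ofCc (conv f g) = ofCc f * ofCc g :=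
  Subtype.ext (FiberOps.ext fun x => leftReg_conv x f g)

theorem ofCc_involution (f : C_c(G, ℂ)) : ofCc (involution f) = star (ofCc f) :=
  Subtype.ext (FiberOps.ext fun x => leftReg_involution x f)

/-- The left regular representation at `x`, extended to `C*_r(G)`. -/
def evalReg (x : UnitSpace G) (a : ReducedCStarAlgebra G) :
    Ell2 (Fiber x) →L[ℂ] Ell2 (Fiber x) := a.1.component x

end reduced

/-! ### The conditional expectation, invariant measures and traces -/

section expectation

open IsTopGroupoid

variable {G : Type u} [TopologicalSpace G] [GroupoidOn G]

theorem isClosed_units [T2Space G] [IsTopGroupoid G] : IsClosed (units : Set G) := by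
  have e : (units : Set G) = {γ : G | ((rng γ : UnitSpace G) : G) = γ} := by
    ext γ
    refine ⟨fun h => congrArg Subtype.val (rng_unit ⟨γ, h⟩), fun h => ?_⟩
    have h' : ((rng γ : UnitSpace G) : G) = γ := h
    rw [← h']
    exact (rng γ).2
  rw [e]
  exact isClosed_eq (continuous_subtype_val.comp continuous_rng) continuous_id

variable [T2Space G] [LocallyCompactSpace G] [IsEtale G]

/-- `E(a)(u) = ⟨λ_u(a) δ_u, δ_u⟩`, as a function on the unit space. (Mathlib's inner product is
conjugate-linear in the first variable.) -/
noncomputable def expectationFun (a : ReducedCStarAlgebra G) (u : UnitSpace G) : ℂ :=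
  inner ℂ (delta (Fiber.unit u)) (evalReg u a (delta (Fiber.unit u)))

theorem expectationFun_ofCc (f : C_c(G, ℂ)) (u : UnitSpace G) :
    expectationFun (ofCc f) u = f (u : G) := by
  unfold expectationFun
  rw [inner_delta_left]
  refine (leftReg_delta u f (Fiber.unit u) (Fiber.unit u)).trans (congrArg f ?_)
  refine (divR_congr _ rfl (congrArg Subtype.val (src_unit u)).symm).trans ?_
  exact divR_unit (u : G)

theorem norm_expectationFun_sub_le (a b : ReducedCStarAlgebra G) (u : UnitSpace G) :
    ‖expectationFun a u - expectationFun b u‖ ≤ ‖a - b‖ := by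
  have hδ : ‖(delta (Fiber.unit u) : Ell2 (Fiber u))‖ = 1 := norm_delta _
  unfold expectationFun
  rw [← inner_sub_right, ← sub_apply]
  refine (norm_inner_le_norm _ _).trans ?_
  rw [hδ, one_mul]
  refine (ContinuousLinearMap.le_opNorm _ _).trans ?_
  rw [hδ, mul_one]
  exact FiberOps.norm_component_le (a.1 - b.1) u

theorem exists_ofCc_near (a : ReducedCStarAlgebra G) {ε : ℝ} (hε : 0 < ε) :
    ∃ f : C_c(G, ℂ), ‖a - ofCc f‖ < ε := by
  obtain ⟨f, hf⟩ := denseRange_ofCc.exists_dist_lt a hε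
  exact ⟨f, by rwa [dist_eq_norm] at hf⟩

theorem continuous_expectationFun (a : ReducedCStarAlgebra G) : Continuous (expectationFun a) := by
  refine continuous_of_uniform_approx_of_continuous fun U hU => ?_
  obtain ⟨ε, hε, hεU⟩ := Metric.mem_uniformity_dist.1 hU
  obtain ⟨f, hf⟩ := exists_ofCc_near a hε
  refine ⟨fun u => f (u : G), f.continuous.comp continuous_subtype_val, fun u => hεU ?_⟩
  change dist (expectationFun a u) (f (u : G)) < ε
  rw [← expectationFun_ofCc, dist_eq_norm]
  exact (norm_expectationFun_sub_le _ _ _).trans_lt hf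

theorem tendsto_expectationFun (a : ReducedCStarAlgebra G) :
    Tendsto (expectationFun a) (cocompact (UnitSpace G)) (𝓝 0) := by
  rw [Metric.tendsto_nhds]
  intro ε hε
  obtain ⟨f, hf⟩ := exists_ofCc_near a hε
  have hK : IsCompact ((Subtype.val : UnitSpace G → G) ⁻¹' tsupport f) :=
    isClosed_units.isClosedEmbedding_subtypeVal.isCompact_preimage f.hasCompactSupport.isCompact
  filter_upwards [hK.compl_mem_cocompact] with u hu
  have h0 : expectationFun (ofCc f) u = 0 := by
    rw [expectationFun_ofCc]
    by_contra hne
    exact hu (subset_tsupport _ hne)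
  rw [dist_eq_norm, ← h0]
  exact (norm_expectationFun_sub_le _ _ _).trans_lt hf

/-- The conditional expectation `E : C*_r(G) → C_0(G⁽⁰⁾)`. -/
noncomputable def expectation (a : ReducedCStarAlgebra G) : C₀(UnitSpace G, ℂ) where
  toFun := expectationFun a
  continuous_toFun := continuous_expectationFun a
  zero_at_infty' := tendsto_expectationFun a

variable [MeasurableSpace G]

/-- The functional `τ_μ(a) = ∫ E(a) dμ` on `C*_r(G)`. -/
noncomputable def traceOf (μ : Measure (UnitSpace G)) (a : ReducedCStarAlgebra G) : ℂ :=
  ∫ u, expectation a u ∂μ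

/-- The tracial ideal `I_μ = {a ∈ C*_r(G) : τ_μ(a* a) = 0}`. -/
def tracialIdeal (μ : Measure (UnitSpace G)) : Set (ReducedCStarAlgebra G) :=
  {a | traceOf μ (star a * a) = 0}

end expectation

section invariantMeasure

open IsTopGroupoid

variable {G : Type u} [TopologicalSpace G] [GroupoidOn G]

/-- An open bisection: an open set of arrows on which `src` and `rng` are homeomorphisms onto their
images. -/
structure IsOpenBisection (B : Set G) : Prop where
  isOpen : IsOpen B
  src_embedding : IsEmbedding fun b : B => (src b.1 : UnitSpace G)
  rng_embedding : IsEmbedding fun b : B => (rng b.1 : UnitSpace G)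

/-- The map `α_B : s(B) → r(B)`, `x ↦ r((s|_B)⁻¹(x))`, of a bisection `B`. -/
noncomputable def bisectionMap (B : Set G) (x : (src '' B : Set (UnitSpace G))) : UnitSpace G :=
  rng (Classical.choose x.2)

/-- A measure on the unit space is invariant if `(α_B)_*(μ|_{s(B)}) = μ|_{r(B)}` for every open
bisection `B`. -/
def IsInvariantMeasure [MeasurableSpace G] (μ : Measure (UnitSpace G)) : Prop :=
  ∀ B : Set G, IsOpenBisection B →
    (μ.comap (Subtype.val : (src '' B : Set (UnitSpace G)) → UnitSpace G)).map (bisectionMap B) =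
      μ.restrict (rng '' B)

/-- A set `Y` of units is invariant if `r⁻¹(Y) = s⁻¹(Y)`. -/
def IsInvariantSet {G : Type u} [GroupoidOn G] (Y : Set (UnitSpace G)) : Prop :=
  (rng : G → UnitSpace G) ⁻¹' Y = (src : G → UnitSpace G) ⁻¹' Y

theorem IsInvariantSet.rng_mem {G : Type u} [GroupoidOn G] {Y : Set (UnitSpace G)} (hY : IsInvariantSet Y) {γ : G}
    (h : src γ ∈ Y) : rng γ ∈ Y := by
  have : γ ∈ (src : G → UnitSpace G) ⁻¹' Y := h
  rwa [← hY] at this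

theorem continuous_bisectionMap [IsTopGroupoid G] {B : Set G} (hB : IsOpenBisection B) :
    Continuous (bisectionMap B) := by
  let σ : (src '' B : Set (UnitSpace G)) → B :=
    fun x => ⟨Classical.choose x.2, (Classical.choose_spec x.2).1⟩
  have hσ : Continuous σ := by
    rw [hB.src_embedding.continuous_iff]
    have e : (fun b : B => (src b.1 : UnitSpace G)) ∘ σ = Subtype.val :=
      funext fun x => (Classical.choose_spec x.2).2
    rw [e]
    exact continuous_subtype_val
  exact continuous_rng.comp (continuous_subtype_val.comp hσ)

theorem IsOpenBisection.mono [IsTopGroupoid G] {B B' : Set G} (hB : IsOpenBisection B)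
    (hB' : IsOpen B') (h : B' ⊆ B) : IsOpenBisection B' where
  isOpen := hB'
  src_embedding := hB.src_embedding.comp (IsEmbedding.inclusion h)
  rng_embedding := hB.rng_embedding.comp (IsEmbedding.inclusion h)

theorem exists_isOpenBisection [IsEtale G] (γ : G) : ∃ B : Set G, γ ∈ B ∧ IsOpenBisection B := by
  obtain ⟨U, hU, hUe⟩ :=
    isLocalHomeomorph_iff_isOpenEmbedding_restrict.1 (isLocalHomeomorph_src (G := G)) γ
  obtain ⟨V, hV, hVe⟩ :=
    isLocalHomeomorph_iff_isOpenEmbedding_restrict.1 (IsEtale.isLocalHomeomorph_rng (G := G)) γ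
  have hUV : interior U ∩ interior V ⊆ U :=
    Set.inter_subset_left.trans interior_subset
  have hUV' : interior U ∩ interior V ⊆ V :=
    Set.inter_subset_right.trans interior_subset
  exact ⟨interior U ∩ interior V, ⟨mem_interior_iff_mem_nhds.2 hU, mem_interior_iff_mem_nhds.2 hV⟩,
    isOpen_interior.inter isOpen_interior,
    hUe.isEmbedding.comp (IsEmbedding.inclusion hUV),
    hVe.isEmbedding.comp (IsEmbedding.inclusion hUV')⟩

theorem IsInvariantMeasure.measure_image_eq [IsEtale G] [MeasurableSpace G] [BorelSpace G]
    {μ : Measure (UnitSpace G)} (hμ : IsInvariantMeasure μ) {B : Set G} (hB : IsOpenBisection B) :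
    μ (src '' B) = μ (rng '' B) := by
  have h := congrArg (fun ν => ν Set.univ) (hμ B hB)
  have hs : MeasurableSet (src '' B : Set (UnitSpace G)) :=
    ((isLocalHomeomorph_src (G := G)).isOpenMap _ hB.isOpen).measurableSet
  simp only [Measure.restrict_apply_univ] at h
  rw [Measure.map_apply (continuous_bisectionMap hB).measurable MeasurableSet.univ,
    Set.preimage_univ, comap_subtype_coe_apply hs] at h
  rwa [Set.image_univ, Subtype.range_coe] at h

theorem isInvariantSet_support [IsEtale G] [MeasurableSpace G] [BorelSpace G]
    {μ : Measure (UnitSpace G)} (hμ : IsInvariantMeasure μ) : IsInvariantSet μ.support := by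
  have key : ∀ γ : G, src γ ∈ μ.support → rng γ ∈ μ.support := by
    intro γ hγ
    rw [Measure.mem_support_iff_forall] at hγ ⊢
    intro V hV
    obtain ⟨B, hγB, hB⟩ := exists_isOpenBisection γ
    let W : Set G := B ∩ rng ⁻¹' interior V
    have hW : IsOpenBisection W :=
      hB.mono (hB.isOpen.inter (isOpen_interior.preimage continuous_rng)) Set.inter_subset_left
    have hγW : γ ∈ W := ⟨hγB, mem_interior_iff_mem_nhds.2 hV⟩
    have hpos : 0 < μ (src '' W) :=
      hγ _ (((isLocalHomeomorph_src (G := G)).isOpenMap _ hW.isOpen).mem_nhds ⟨γ, hγW, rfl⟩)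
    rw [hμ.measure_image_eq hW] at hpos
    refine hpos.trans_le (measure_mono ?_)
    rintro _ ⟨a, ha, rfl⟩
    exact interior_subset ha.2
  ext γ
  refine ⟨fun h => ?_, key γ⟩
  have := key (inv γ) (by rw [src_inv]; exact h)
  rwa [rng_inv] at this

instance fact_isClosed_support [MeasurableSpace G] (μ : Measure (UnitSpace G)) :
    Fact (IsClosed μ.support) := ⟨Measure.isClosed_support⟩

end invariantMeasure

/-! ### Reductions to invariant sets of units -/

section reduction

open IsTopGroupoid

variable {G : Type u} [TopologicalSpace G] [GroupoidOn G]

/-- The reduction `G_Y = s⁻¹(Y)` of a groupoid to an invariant set `Y` of units. -/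
def Reduction (Y : Set (UnitSpace G)) (_ : IsInvariantSet Y) : Type u := {γ : G // src γ ∈ Y}

variable {Y : Set (UnitSpace G)} {hY : IsInvariantSet Y}

instance : TopologicalSpace (Reduction Y hY) := instTopologicalSpaceSubtype

instance [T2Space G] : T2Space (Reduction Y hY) := inferInstanceAs (T2Space {γ : G // src γ ∈ Y})

theorem Reduction.ext {G : Type u} [GroupoidOn G] {Y : Set (UnitSpace G)}
    {hY : IsInvariantSet Y} {a b : Reduction Y hY} (h : a.1 = b.1) : a = b := Subtype.ext h

/-- The groupoid structure of `G_Y`, restricted from that of `G`. -/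
instance : GroupoidOn (Reduction Y hY) where
  units := {γ | γ.1 ∈ (units : Set G)}
  src γ := ⟨⟨((src γ.1 : UnitSpace G) : G), by rw [src_unit]; exact γ.2⟩, (src γ.1).2⟩
  rng γ := ⟨⟨((rng γ.1 : UnitSpace G) : G), by rw [src_unit]; exact hY.rng_mem γ.2⟩, (rng γ.1).2⟩
  mul a b h := ⟨mul a.1 b.1 (Subtype.ext (congrArg (fun x => x.1.1) h)), by
    rw [src_mul]; exact b.2⟩
  inv a := ⟨inv a.1, by rw [src_inv]; exact hY.rng_mem a.2⟩
  src_unit x := Subtype.ext (Reduction.ext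
    (congrArg (fun y : UnitSpace G => (y : G)) (src_unit ⟨x.1.1, x.2⟩)))
  rng_unit x := Subtype.ext (Reduction.ext
    (congrArg (fun y : UnitSpace G => (y : G)) (rng_unit ⟨x.1.1, x.2⟩)))
  src_mul a b h := Subtype.ext (Reduction.ext
    (congrArg (fun y : UnitSpace G => (y : G)) (src_mul a.1 b.1 _)))
  rng_mul a b h := Subtype.ext (Reduction.ext
    (congrArg (fun y : UnitSpace G => (y : G))
      (rng_mul a.1 b.1 (Subtype.ext (congrArg (fun x => x.1.1) h)))))
  mul_assoc a b c h h' := Reduction.ext (GroupoidOn.mul_assoc a.1 b.1 c.1 _ _)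
  mul_unit a := Reduction.ext (mul_unit a.1)
  unit_mul a := Reduction.ext (unit_mul a.1)
  src_inv a := Subtype.ext (Reduction.ext
    (congrArg (fun y : UnitSpace G => (y : G)) (src_inv a.1)))
  rng_inv a := Subtype.ext (Reduction.ext
    (congrArg (fun y : UnitSpace G => (y : G)) (rng_inv a.1)))
  inv_mul a := Reduction.ext (inv_mul a.1)
  mul_inv a := Reduction.ext (GroupoidOn.mul_inv a.1)

/-- The inclusion `G_Y⁽⁰⁾ → G⁽⁰⁾`. -/
def Reduction.unitVal (x : UnitSpace (Reduction Y hY)) : UnitSpace G := ⟨x.1.1, x.2⟩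

theorem Reduction.isEmbedding_val :
    IsEmbedding (fun γ : Reduction Y hY => (γ.1 : G)) := IsEmbedding.subtypeVal

theorem Reduction.isEmbedding_unitVal :
    IsEmbedding (Reduction.unitVal : UnitSpace (Reduction Y hY) → UnitSpace G) := by
  refine IsEmbedding.of_comp ?_ continuous_subtype_val
    (Reduction.isEmbedding_val.comp IsEmbedding.subtypeVal)
  exact Continuous.subtype_mk
    (Reduction.isEmbedding_val.continuous.comp continuous_subtype_val) _

theorem Reduction.unitVal_src {G : Type u} [GroupoidOn G] {Y : Set (UnitSpace G)}
    {hY : IsInvariantSet Y} (γ : Reduction Y hY) : Reduction.unitVal (src γ) = src γ.1 := rfl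

theorem Reduction.unitVal_rng {G : Type u} [GroupoidOn G] {Y : Set (UnitSpace G)}
    {hY : IsInvariantSet Y} (γ : Reduction Y hY) : Reduction.unitVal (rng γ) = rng γ.1 := rfl

theorem Reduction.unitVal_mem {G : Type u} [GroupoidOn G] {Y : Set (UnitSpace G)}
    {hY : IsInvariantSet Y} (x : UnitSpace (Reduction Y hY)) : Reduction.unitVal x ∈ Y := by
  have h : src x.1.1 ∈ Y := x.1.2
  have e : src x.1.1 = Reduction.unitVal x := src_unit (Reduction.unitVal x)
  rwa [e] at h

instance [IsTopGroupoid G] : IsTopGroupoid (Reduction Y hY) where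
  continuous_src := Reduction.isEmbedding_unitVal.continuous_iff.2
    (continuous_src.comp Reduction.isEmbedding_val.continuous)
  continuous_rng := Reduction.isEmbedding_unitVal.continuous_iff.2
    (continuous_rng.comp Reduction.isEmbedding_val.continuous)
  continuous_inv := Reduction.isEmbedding_val.continuous_iff.2
    (IsTopGroupoid.continuous_inv.comp Reduction.isEmbedding_val.continuous)
  continuous_mul := by
    refine Reduction.isEmbedding_val.continuous_iff.2 ?_
    have h : Continuous fun p : {p : Reduction Y hY × Reduction Y hY // src p.1 = rng p.2} =>
        ((p.1.1.1, p.1.2.1) : G × G) :=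
      (Reduction.isEmbedding_val.continuous.comp
        (continuous_fst.comp continuous_subtype_val)).prodMk
        (Reduction.isEmbedding_val.continuous.comp (continuous_snd.comp continuous_subtype_val))
    exact IsTopGroupoid.continuous_mul.comp
      (Continuous.subtype_mk h fun p => congrArg Reduction.unitVal p.2)

instance [IsEtale G] : IsEtale (Reduction Y hY) where
  isLocalHomeomorph_rng := by
    rw [isLocalHomeomorph_iff_isOpenEmbedding_restrict]
    intro γ
    obtain ⟨U, hU, hUe⟩ :=
      isLocalHomeomorph_iff_isOpenEmbedding_restrict.1 (IsEtale.isLocalHomeomorph_rng (G := G)) γ.1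
    let V : Set (Reduction Y hY) := (fun γ : Reduction Y hY => (γ.1 : G)) ⁻¹' interior U
    have hV : IsOpen V := isOpen_interior.preimage Reduction.isEmbedding_val.continuous
    have hγV : γ ∈ V := mem_interior_iff_mem_nhds.2 hU
    let i : V → U := fun v => ⟨v.1.1, interior_subset v.2⟩
    have hi : IsEmbedding i := by
      refine IsEmbedding.of_comp ?_ continuous_subtype_val
        (Reduction.isEmbedding_val.comp IsEmbedding.subtypeVal)
      exact Continuous.subtype_mk
        (Reduction.isEmbedding_val.continuous.comp continuous_subtype_val) _
    refine ⟨V, hV.mem_nhds hγV, ?_, ?_⟩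
    · have hc : Continuous fun v : V => (rng v.1 : UnitSpace (Reduction Y hY)) :=
        IsTopGroupoid.continuous_rng.comp continuous_subtype_val
      exact IsEmbedding.of_comp hc Reduction.isEmbedding_unitVal.continuous
        (hUe.isEmbedding.comp hi)
    · have e : Set.range (V.domRestrict (rng : Reduction Y hY → UnitSpace (Reduction Y hY))) =
          Reduction.unitVal ⁻¹' ((rng : G → UnitSpace G) '' interior U) := by
        ext x
        constructor
        · rintro ⟨v, rfl⟩
          exact ⟨v.1.1, v.2, rfl⟩
        · rintro ⟨a, ha, hax⟩
          have haY : src a ∈ Y := by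
            have h1 : a ∈ (rng : G → UnitSpace G) ⁻¹' Y := by
              change rng a ∈ Y
              rw [hax]
              exact Reduction.unitVal_mem x
            rwa [hY] at h1
          exact ⟨⟨⟨a, haY⟩, ha⟩, Reduction.isEmbedding_unitVal.injective hax⟩
      rw [e]
      exact ((IsEtale.isLocalHomeomorph_rng (G := G)).isOpenMap _ isOpen_interior).preimage
        Reduction.isEmbedding_unitVal.continuous

instance [T2Space G] [LocallyCompactSpace G] [IsTopGroupoid G] [hc : Fact (IsClosed Y)] :
    LocallyCompactSpace (Reduction Y hY) :=
  (hc.out.preimage (continuous_src (G := G))).isClosedEmbedding_subtypeVal.locallyCompactSpace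

/-- Restriction of functions `C_c(G) → C_c(G_Y)` for a closed invariant set `Y`. -/
noncomputable def restrictCc [IsTopGroupoid G] [hc : Fact (IsClosed Y)] (hY : IsInvariantSet Y)
    (f : C_c(G, ℂ)) : C_c(Reduction Y hY, ℂ) where
  toFun γ := f γ.1
  continuous_toFun := f.continuous.comp continuous_subtype_val
  hasCompactSupport' := f.hasCompactSupport.comp_isClosedEmbedding
    (hc.out.preimage (continuous_src (G := G))).isClosedEmbedding_subtypeVal

end reduction

end GroupoidCStar

/-! Write Y for the support of μ. Restricting a family of operators over the unit space to the units
in Y is a contractive `*`-homomorphism. The fibre of the reduction over a unit in Y is the same set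
as the fibre of the whole groupoid, so this map carries λ(f) to λ(f|_Y). It therefore maps the
closure of the image of C_c into the closure of the image of C_c of the reduction, which gives π
(`restriction`). By construction π(a) = 0 exactly when λ_x(a) = 0 for every x in Y.

The kernel is I_μ for two reasons. First, E(a*a)(u) = ‖λ_u(a)δ_u‖² is continuous and nonnegative, so
its μ-integral vanishes iff λ_u(a)δ_u = 0 for every u in Y (`mem_tracialIdeal_iff`). Second,
λ_x(a)δ_α is a right translate of λ_{r(α)}(a)δ_{r(α)}. Since Y is invariant, vanishing on the unit
vectors over Y forces λ_x(a) = 0 for all x in Y (`evalReg_eq_zero_of_delta_unit`). That I_μ is a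
closed two-sided ideal then comes for free, since it is the kernel of a continuous homomorphism.

Surjectivity has two ingredients. By Tietze, every C_c function on the closed reduction is the
restriction of one on G, so π has dense range. A continuous `*`-homomorphism of C⋆-algebras has
closed range, because elements of the range have preimages of controlled norm
(`surjective_of_denseRange`). -/

namespace GroupoidCStar

/-! ### Closed range of `*`-homomorphisms, by lifting with norm control. -/

section cstar

variable {A B : Type*} [NonUnitalCStarAlgebra A] [NonUnitalCStarAlgebra B]

theorem norm_quasispectrum_le_of_isSelfAdjoint {b : B} (hb : IsSelfAdjoint b) {t : ℝ}
    (ht : t ∈ quasispectrum ℝ b) : ‖t‖ ≤ ‖b‖ := by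
  have := norm_apply_le_norm_cfcₙ (𝕜 := ℝ) (fun x : ℝ => x) b ht
  rwa [cfcₙ_id' ℝ b] at this

/-- A self-adjoint element has a preimage of no larger norm under a `*`-homomorphism as soon as it
has a preimage. -/
theorem exists_lift_norm_le_of_isSelfAdjoint (φ : A →⋆ₙₐ[ℂ] B) (hφ : Continuous φ) {a : A}
    (ha : IsSelfAdjoint a) : ∃ a' : A, φ a' = φ a ∧ ‖a'‖ ≤ ‖φ a‖ := by
  let M := ‖φ a‖
  have hM : 0 ≤ M := norm_nonneg _
  -- Truncation to [-M, M]: applied to `a`, it cuts the norm down to M without changing the image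
  -- under `φ`.
  let h : ℝ → ℝ := fun t => max (-M) (min M t)
  have hc : Continuous h := by fun_prop
  have h0 : h 0 = 0 := by simp [h, hM]
  have hb : IsSelfAdjoint (φ a) := ha.map φ
  refine ⟨cfcₙ h a, ?_, ?_⟩
  · rw [NonUnitalStarAlgHomClass.map_cfcₙ (S := ℂ) φ h a hc.continuousOn h0 hφ ha hb]
    -- The quasispectrum of `φ a` already lies in [-M, M], where the truncation is the identity.
    have e : cfcₙ h (φ a) = cfcₙ (fun t : ℝ => t) (φ a) := cfcₙ_congr fun t ht => by
      have := abs_le.1 (norm_quasispectrum_le_of_isSelfAdjoint hb ht)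
      simp only [h]
      rw [min_eq_right this.2, max_eq_right this.1]
    rw [e, cfcₙ_id' ℝ (φ a)]
  · refine norm_cfcₙ_le fun t _ => ?_
    rw [Real.norm_eq_abs, abs_le]
    exact ⟨le_max_left _ _, max_le (by linarith) (min_le_left _ _)⟩

/-- Real and imaginary parts are lifted separately, each with norm at most ‖φ a‖; the triangle
inequality costs the factor 2. The sharp constant is irrelevant, as only some uniform bound is
needed for closed range. -/
theorem exists_lift_norm_le (φ : A →⋆ₙₐ[ℂ] B) (hφ : Continuous φ) (a : A) :
    ∃ a' : A, φ a' = φ a ∧ ‖a'‖ ≤ 2 * ‖φ a‖ := by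
  obtain ⟨x, hx, hxn⟩ := exists_lift_norm_le_of_isSelfAdjoint φ hφ (realPart a).2
  obtain ⟨y, hy, hyn⟩ := exists_lift_norm_le_of_isSelfAdjoint φ hφ (imaginaryPart a).2
  have e1 : φ (realPart a : A) = (realPart (φ a) : B) := by
    simp [realPart_apply_coe, map_real_smul φ hφ, map_star, -smul_add]
  have e2 : φ (imaginaryPart a : A) = (imaginaryPart (φ a) : B) := by
    simp [imaginaryPart_apply_coe, map_real_smul φ hφ, map_star]
  have n1 : ‖(realPart (φ a) : B)‖ ≤ ‖φ a‖ := realPart.norm_le (φ a)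
  have n2 : ‖(imaginaryPart (φ a) : B)‖ ≤ ‖φ a‖ := imaginaryPart.norm_le (φ a)
  refine ⟨x + Complex.I • y, ?_, ?_⟩
  · rw [map_add, map_smul, hx, hy, e1, e2, realPart_add_I_smul_imaginaryPart]
  · refine (norm_add_le _ _).trans ?_
    rw [norm_smul, Complex.norm_I, one_mul]
    rw [e1] at hxn
    rw [e2] at hyn
    linarith

/-- A continuous `*`-homomorphism of C⋆-algebras with dense range is surjective. -/
theorem surjective_of_denseRange (φ : A →⋆ₙₐ[ℂ] B) (hφ : Continuous φ) (hd : DenseRange φ) :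
    Function.Surjective φ := by
  let L : A →L[ℂ] B := ⟨(φ : A →ₗ[ℂ] B), hφ⟩
  let f : NormedAddGroupHom A B :=
    (φ : A →+ B).mkNormedAddGroupHom ‖L‖ fun a => L.le_opNorm a
  have hyp : f.SurjectiveOnWith f.range 2 := by
    rintro _ ⟨a, rfl⟩
    exact exists_lift_norm_le φ hφ a
  -- Successive approximation: controlled preimages of the terms of a rapidly convergent series sum
  -- in the complete algebra `A`. The loss of 1 in the constant is arbitrary.
  have h := controlled_closure_of_complete (by norm_num) one_pos hyp
  intro b
  have hb : b ∈ f.range.topologicalClosure := by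
    have : b ∈ closure (Set.range φ) := hd b
    refine closure_mono ?_ this
    rintro _ ⟨a, rfl⟩
    exact ⟨a, rfl⟩
  obtain ⟨a, ha, -⟩ := h b hb
  exact ⟨a, ha⟩

end cstar

/-! ### Extending compactly supported functions from a closed subspace. -/

section topologyExtension

/-- A compactly supported function on a closed subspace of a locally compact Hausdorff space extends
to a compactly supported function on the whole space. -/
theorem exists_cc_extension {X Z : Type u} [TopologicalSpace X] [T2Space X]
    [LocallyCompactSpace X] [TopologicalSpace Z] {i : Z → X} (hi : IsClosedEmbedding i)
    (f : C_c(Z, ℂ)) : ∃ g : C_c(X, ℂ), ∀ z, g (i z) = f z := by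
  have hK : IsCompact (i '' tsupport f) := f.hasCompactSupport.isCompact.image hi.continuous
  -- Tietze needs a normal space, and `X` is only locally compact Hausdorff. The extension is
  -- therefore made on a compact neighbourhood `K'` of the support, then cut off by a bump function
  -- `χ` that is 1 on the support and 0 outside the interior of `K'`.
  obtain ⟨K', hK', hKK'⟩ := exists_compact_superset hK
  obtain ⟨χ, hχ1, hχ0, -, -⟩ := exists_continuous_one_zero_of_isCompact hK
    isOpen_interior.isClosed_compl (Set.disjoint_compl_right_iff_subset.2 hKK')
  have : CompactSpace K' := isCompact_iff_compactSpace.1 hK'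
  let j : (i ⁻¹' K' : Set Z) → K' := fun z => ⟨i z.1, z.2⟩
  have hj : IsClosedEmbedding j := by
    have h1 : IsClosedEmbedding ((Subtype.val : K' → X) ∘ j) :=
      hi.comp (hK'.isClosed.preimage hi.continuous).isClosedEmbedding_subtypeVal
    exact (IsClosedEmbedding.of_comp_iff hK'.isClosed.isClosedEmbedding_subtypeVal).1 h1
  obtain ⟨g, hg⟩ := ContinuousMap.exists_extension' hj
    (⟨fun z => f z.1, f.continuous.comp continuous_subtype_val⟩ : C((i ⁻¹' K' : Set Z), ℂ))
  have hg' : ∀ z (hz : i z ∈ K'), g ⟨i z, hz⟩ = f z := fun z hz => congrFun hg ⟨z, hz⟩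
  classical
  let F : X → ℂ := fun x => if hx : x ∈ K' then (χ x : ℂ) * g ⟨x, hx⟩ else 0
  have hF0 : ∀ x ∉ interior K', F x = 0 := fun x hx => by
    have : χ x = 0 := hχ0 hx
    simp [F, this]
  -- Continuity is glued over two closed sets covering `X`: `K'`, where `F` is a product of
  -- continuous functions, and the complement of its interior, where `F` vanishes.
  have hFc : Continuous F := by
    have hcl : ContinuousOn F K' := by
      rw [continuousOn_iff_continuous_domRestrict]
      have : K'.domRestrict F = fun x : K' => (χ x.1 : ℂ) * g x := by
        funext x
        simp [F, x.2]
      rw [this]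
      fun_prop
    have hcl' : ContinuousOn F (interior K')ᶜ :=
      continuousOn_const.congr fun x hx => hF0 x hx
    have := hcl.union_of_isClosed hcl' hK'.isClosed isOpen_interior.isClosed_compl
    rwa [show K' ∪ (interior K')ᶜ = Set.univ from Set.eq_univ_of_forall fun x => by
      by_cases hx : x ∈ K'
      · exact Or.inl hx
      · exact Or.inr fun h => hx (interior_subset h), continuousOn_univ] at this
  refine ⟨⟨⟨F, hFc⟩, HasCompactSupport.intro hK' fun x hx =>
    hF0 x fun h => hx (interior_subset h)⟩, fun z => ?_⟩
  change F (i z) = f z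
  by_cases hz : i z ∈ K'
  · simp only [F, hz, dif_pos, hg']
    by_cases hfz : f z = 0
    · simp [hfz]
    · have : χ (i z) = 1 := hχ1 ⟨z, subset_tsupport _ hfz, rfl⟩
      simp [this]
  · have : f z = 0 := by
      by_contra hfz
      exact hz (interior_subset (hKK' ⟨z, subset_tsupport _ hfz, rfl⟩))
    simp [F, hz, this]

end topologyExtension
open GroupoidOn

/-! ### Unitaries of ℓ² spaces induced by bijections of the index sets. -/

section reindex

variable {ι κ : Type u}

theorem memℓp_comp_equiv (e : κ ≃ ι) (ξ : Ell2 ι) :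
    Memℓp (E := fun _ : κ => ℂ) (fun k => ξ (e k)) 2 := by
  have h := (memℓp_gen_iff (p := 2) (by simp)).1 (lp.memℓp ξ)
  exact (memℓp_gen_iff (p := 2) (by simp)).2 (h.comp_injective e.injective)

/-- The unitary `ℓ²(ι) ≃ ℓ²(κ)` induced by a bijection of the index sets. -/
noncomputable def reindexEll2 (e : κ ≃ ι) : Ell2 ι ≃ₗᵢ[ℂ] Ell2 κ where
  toFun ξ := ⟨fun k => ξ (e k), memℓp_comp_equiv e ξ⟩
  invFun η := ⟨fun i => η (e.symm i), memℓp_comp_equiv e.symm η⟩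
  left_inv ξ := by ext i; exact congrArg ξ (e.apply_symm_apply i)
  right_inv η := by ext k; exact congrArg η (e.symm_apply_apply k)
  map_add' _ _ := rfl
  map_smul' _ _ := rfl
  norm_map' ξ := by
    rw [lp.norm_eq_tsum_rpow (p := 2) (by simp), lp.norm_eq_tsum_rpow (p := 2) (by simp)]
    congr 1
    exact e.tsum_eq fun i => ‖ξ i‖ ^ (2 : ℝ≥0∞).toReal

theorem reindexEll2_apply (e : κ ≃ ι) (ξ : Ell2 ι) (k : κ) : reindexEll2 e ξ k = ξ (e k) := rfl

theorem reindexEll2_delta (e : κ ≃ ι) (k : κ) : reindexEll2 e (delta (e k)) = delta k := by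
  classical
  ext l
  rw [reindexEll2_apply]
  unfold delta
  by_cases h : l = k
  · subst h; simp
  · simp [lp.single_apply, h]

theorem reindexEll2_symm_delta (e : κ ≃ ι) (k : κ) :
    (reindexEll2 e).symm (delta k) = delta (e k) := by
  rw [← reindexEll2_delta, LinearIsometryEquiv.symm_apply_apply]

end reindex

/-! ### Restriction of operator families to an invariant set of units. -/

section restrictOps

variable {G : Type u} [GroupoidOn G] {Y : Set (UnitSpace G)} {hY : IsInvariantSet Y}

/-- The fibre of `G_Y` over `x ∈ Y` is the fibre of `G` over `x`. -/
def Reduction.fiberEquiv (x : UnitSpace (Reduction Y hY)) :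
    Fiber x ≃ Fiber (Reduction.unitVal x) where
  toFun γ := ⟨γ.1.1, congrArg Reduction.unitVal γ.2⟩
  invFun γ := ⟨⟨γ.1, by rw [γ.2]; exact Reduction.unitVal_mem x⟩,
    Subtype.ext (Reduction.ext (congrArg (fun y : UnitSpace G => (y : G)) γ.2))⟩
  left_inv _ := rfl
  right_inv _ := rfl

/-- The isomorphism `B(ℓ²(G_x)) ≃ B(ℓ²((G_Y)_x))` for `x ∈ Y`. -/
noncomputable def Reduction.fiberConj (x : UnitSpace (Reduction Y hY)) :
    (Ell2 (Fiber (Reduction.unitVal x)) →L[ℂ] Ell2 (Fiber (Reduction.unitVal x))) ≃⋆ₐ[ℂ]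
      (Ell2 (Fiber x) →L[ℂ] Ell2 (Fiber x)) :=
  (reindexEll2 (Reduction.fiberEquiv x)).conjStarAlgEquiv

theorem Reduction.norm_fiberConj_le (x : UnitSpace (Reduction Y hY))
    (T : Ell2 (Fiber (Reduction.unitVal x)) →L[ℂ] Ell2 (Fiber (Reduction.unitVal x))) :
    ‖Reduction.fiberConj x T‖ ≤ ‖T‖ := by
  refine ContinuousLinearMap.opNorm_le_bound _ (norm_nonneg _) fun ξ => ?_
  let U := reindexEll2 (Reduction.fiberEquiv x)
  exact (U.norm_map _).trans_le ((T.le_opNorm (U.symm ξ)).trans_eq (by rw [U.symm.norm_map]))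

theorem Reduction.fiberConj_delta (x : UnitSpace (Reduction Y hY))
    (T : Ell2 (Fiber (Reduction.unitVal x)) →L[ℂ] Ell2 (Fiber (Reduction.unitVal x)))
    (γ α : Fiber x) :
    Reduction.fiberConj x T (delta α) γ =
      T (delta (Reduction.fiberEquiv x α)) (Reduction.fiberEquiv x γ) := by
  rw [← reindexEll2_symm_delta]
  rfl

/-- Restriction of a family of operators over `G⁽⁰⁾` to one over `Y`. -/
noncomputable def restrictOps (hY : IsInvariantSet Y) :
    FiberOps G →⋆ₙₐ[ℂ] FiberOps (Reduction Y hY) where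
  toFun T := ⟨fun x => Reduction.fiberConj x (T.component (Reduction.unitVal x)),
    memℓp_infty ⟨‖T‖, by
      rintro _ ⟨x, rfl⟩
      exact (Reduction.norm_fiberConj_le x _).trans (T.norm_component_le _)⟩⟩
  map_smul' c T := FiberOps.ext fun x =>
    map_smul (Reduction.fiberConj x) c (T.component (Reduction.unitVal x))
  map_zero' := FiberOps.ext fun x => map_zero (Reduction.fiberConj x)
  map_add' S T := FiberOps.ext fun x =>
    map_add (Reduction.fiberConj x) (S.component (Reduction.unitVal x))
      (T.component (Reduction.unitVal x))
  map_mul' S T := FiberOps.ext fun x =>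
    map_mul (Reduction.fiberConj x) (S.component (Reduction.unitVal x))
      (T.component (Reduction.unitVal x))
  map_star' T := FiberOps.ext fun x =>
    map_star (Reduction.fiberConj x) (T.component (Reduction.unitVal x))

theorem restrictOps_component (T : FiberOps G) (x : UnitSpace (Reduction Y hY)) :
    (restrictOps hY T).component x =
      Reduction.fiberConj x (T.component (Reduction.unitVal x)) := rfl

/-- Conjugation by a unitary does not increase norms, and the supremum now runs over fewer units. -/
theorem norm_restrictOps_le (T : FiberOps G) : ‖restrictOps hY T‖ ≤ ‖T‖ :=
  lp.norm_le_of_forall_le (norm_nonneg _) fun x =>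
    (Reduction.norm_fiberConj_le x _).trans (T.norm_component_le _)

theorem continuous_restrictOps : Continuous (restrictOps hY : FiberOps G → _) :=
  AddMonoidHomClass.continuous_of_bound (restrictOps hY) 1 fun T => by
    rw [one_mul]; exact norm_restrictOps_le T

end restrictOps

/-! ### The restriction homomorphism between reduced algebras and its surjectivity. -/

section restriction

variable {G : Type u} [TopologicalSpace G] [GroupoidOn G] [IsEtale G]
  {Y : Set (UnitSpace G)} [hc : Fact (IsClosed Y)] {hY : IsInvariantSet Y}

/-- Both operators have matrix coefficient f(γα⁻¹) at (γ, α), since division in the reduction is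
computed in `G`. -/
theorem restrictOps_regRep (f : C_c(G, ℂ)) :
    restrictOps hY (regRep G f) = regRep _ (restrictCc hY f) := by
  refine FiberOps.ext fun x => ext_delta fun γ α => ?_
  rw [restrictOps_component, Reduction.fiberConj_delta, regRep_apply, regRep_apply,
    leftReg_delta, leftReg_delta]
  rfl

variable [T2Space G] [LocallyCompactSpace G]

theorem restrictOps_mem (a : ReducedCStarAlgebra G) :
    restrictOps hY a.1 ∈ reducedSubalgebra (Reduction Y hY) := by
  refine map_mem_closure (s := Set.range (regRep G)) continuous_restrictOps a.2 ?_
  rintro _ ⟨f, rfl⟩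
  exact ⟨restrictCc hY f, (restrictOps_regRep f).symm⟩

/-- The restriction homomorphism `C*_r(G) → C*_r(G_Y)`. -/
noncomputable def restriction (hY : IsInvariantSet Y) :
    ReducedCStarAlgebra G →⋆ₙₐ[ℂ] ReducedCStarAlgebra (Reduction Y hY) where
  toFun a := ⟨restrictOps hY a.1, restrictOps_mem a⟩
  map_smul' c a := Subtype.ext (map_smul (restrictOps hY) c a.1)
  map_zero' := Subtype.ext (map_zero (restrictOps hY))
  map_add' a b := Subtype.ext (map_add (restrictOps hY) a.1 b.1)
  map_mul' a b := Subtype.ext (map_mul (restrictOps hY) a.1 b.1)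
  map_star' a := Subtype.ext (map_star (restrictOps hY) a.1)

theorem continuous_restriction :
    Continuous (restriction hY : ReducedCStarAlgebra G → ReducedCStarAlgebra (Reduction Y hY)) :=
  Continuous.subtype_mk (continuous_restrictOps.comp continuous_subtype_val) _

theorem restriction_ofCc (f : C_c(G, ℂ)) :
    restriction hY (ofCc f) = ofCc (restrictCc hY f) := Subtype.ext (restrictOps_regRep f)

theorem restrictCc_surjective :
    Function.Surjective (restrictCc hY : C_c(G, ℂ) → C_c(Reduction Y hY, ℂ)) := by
  intro f
  obtain ⟨g, hg⟩ := exists_cc_extension (i := fun γ : Reduction Y hY => (γ.1 : G))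
    (hc.out.preimage (IsTopGroupoid.continuous_src (G := G))).isClosedEmbedding_subtypeVal f
  exact ⟨g, by ext γ; exact hg γ⟩

theorem restriction_surjective :
    Function.Surjective
      (restriction hY : ReducedCStarAlgebra G → ReducedCStarAlgebra (Reduction Y hY)) := by
  refine surjective_of_denseRange _ continuous_restriction ?_
  refine (denseRange_ofCc (G := Reduction Y hY)).mono ?_
  rintro _ ⟨f, rfl⟩
  obtain ⟨g, rfl⟩ := restrictCc_surjective f
  exact ⟨ofCc g, restriction_ofCc g⟩

/-- Each component of the restriction is a unitary conjugate of λ_x(a), and every x in `Y` occurs as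
a unit of the reduction. -/
theorem restriction_eq_zero_iff (a : ReducedCStarAlgebra G) :
    restriction hY a = 0 ↔ ∀ x ∈ Y, evalReg x a = 0 := by
  constructor
  · intro h x hx
    let y : UnitSpace (Reduction Y hY) :=
      ⟨⟨(x : G), by rw [src_unit]; exact hx⟩, x.2⟩
    have h1 : Reduction.fiberConj y (evalReg x a) = 0 :=
      congrArg (fun b : ReducedCStarAlgebra (Reduction Y hY) => b.1.component y) h
    exact (map_eq_zero_iff _ (Reduction.fiberConj y).injective).1 h1
  · intro h
    refine Subtype.ext (FiberOps.ext fun x => ?_)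
    change Reduction.fiberConj x (evalReg (Reduction.unitVal x) a) = 0
    rw [h _ (Reduction.unitVal_mem x), map_zero]

theorem continuous_evalReg (x : UnitSpace G) :
    Continuous (evalReg x : ReducedCStarAlgebra G → _) := by
  refine (LipschitzWith.of_dist_le_mul (K := 1) fun a b => ?_).continuous
  rw [dist_eq_norm, dist_eq_norm, NNReal.coe_one, one_mul]
  exact FiberOps.norm_component_le (a.1 - b.1) x

/-- Right translation by `α` intertwines the regular representations at `s(α)` and `r(α)`. -/
theorem evalReg_delta (a : ReducedCStarAlgebra G) (x : UnitSpace G) (γ α : Fiber x) :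
    evalReg x a (delta α) γ = evalReg (rng α.1) a (delta (Fiber.unit (rng α.1)))
      ⟨divR γ.1 α.1 (γ.src_eq α), src_divR _ _ _⟩ := by
  -- Matrix coefficients depend continuously on `a`, so the identity need only be checked on the
  -- dense image of C_c.
  have hcont : ∀ (y : UnitSpace G) (β δ : Fiber y),
      Continuous fun a : ReducedCStarAlgebra G => evalReg y a (delta β) δ := fun y β δ => by
    have : (fun a : ReducedCStarAlgebra G => evalReg y a (delta β) δ) =
        fun a => inner ℂ (delta δ) (evalReg y a (delta β)) :=
      funext fun a => (inner_delta_left _ _).symm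
    rw [this]
    exact continuous_const.inner ((continuous_evalReg y).clm_apply continuous_const)
  refine congrFun (denseRange_ofCc.equalizer (hcont _ _ _) (hcont _ _ _) (funext fun f => ?_)) a
  -- Both coefficients equal f(γα⁻¹): on the right, γα⁻¹ is divided by the unit r(α), which leaves
  -- it unchanged.
  refine (leftReg_delta x f γ α).trans ((leftReg_delta _ f _ _).trans (congrArg f ?_)).symm
  refine (divR_congr _ rfl (congrArg Subtype.val (src_divR γ.1 α.1 (γ.src_eq α)).symm)).trans ?_
  exact divR_unit _

/-- The column of λ_x(a) at α is a translate of the column of λ_{r(α)}(a) at its unit, and r(α)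
stays in `Y` by invariance. This is where information about E, which sees only unit vectors, becomes
information about whole operators. -/
theorem evalReg_eq_zero_of_delta_unit {Y : Set (UnitSpace G)} (hY : IsInvariantSet Y)
    {a : ReducedCStarAlgebra G}
    (h : ∀ x ∈ Y, evalReg x a (delta (Fiber.unit x)) = 0) {x : UnitSpace G} (hx : x ∈ Y) :
    evalReg x a = 0 := by
  refine ext_delta fun γ α => ?_
  rw [evalReg_delta, h _ (hY.rng_mem (by rw [α.2]; exact hx))]
  rfl

theorem expectationFun_star_mul_self (a : ReducedCStarAlgebra G) (u : UnitSpace G) :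
    expectationFun (star a * a) u = ((‖evalReg u a (delta (Fiber.unit u))‖ ^ 2 : ℝ) : ℂ) := by
  have e : evalReg u (star a * a) = star (evalReg u a) * evalReg u a := rfl
  unfold expectationFun
  rw [e, ContinuousLinearMap.star_eq_adjoint]
  change inner ℂ _ (ContinuousLinearMap.adjoint (evalReg u a) (evalReg u a _)) = _
  rw [ContinuousLinearMap.adjoint_inner_right, inner_self_eq_norm_sq_to_K]
  simp

/-- The Hilbert space varies with u, so continuity is not read off from the vectors; it is inherited
from E(a*a). -/
theorem continuous_norm_sq_evalReg_delta (a : ReducedCStarAlgebra G) :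
    Continuous fun u : UnitSpace G => ‖evalReg u a (delta (Fiber.unit u))‖ ^ 2 := by
  have h := Complex.continuous_re.comp (continuous_expectationFun (star a * a))
  refine h.congr fun u => ?_
  rw [Function.comp_apply, expectationFun_star_mul_self, Complex.ofReal_re]

/-! ### Identification of the tracial ideal with the kernel of restriction. -/

variable [MeasurableSpace G] [BorelSpace G]

/-- A continuous nonnegative integrable function has integral zero iff it vanishes on the support;
here the function is E(a*a). -/
theorem mem_tracialIdeal_iff (μ : Measure (UnitSpace G)) [IsProbabilityMeasure μ] [μ.Regular]
    (a : ReducedCStarAlgebra G) :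
    a ∈ tracialIdeal μ ↔ ∀ x ∈ μ.support, evalReg x a (delta (Fiber.unit x)) = 0 := by
  let F : UnitSpace G → ℝ := fun u => ‖evalReg u a (delta (Fiber.unit u))‖ ^ 2
  have hF : Continuous F := continuous_norm_sq_evalReg_delta a
  have hF0 : ∀ u, F u = 0 ↔ evalReg u a (delta (Fiber.unit u)) = 0 := fun u => by simp [F]
  have hle : ∀ u, ‖F u‖ ≤ ‖a‖ ^ 2 := fun u => by
    rw [Real.norm_of_nonneg (sq_nonneg _)]
    gcongr
    refine (ContinuousLinearMap.le_opNorm _ _).trans ?_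
    rw [norm_delta, mul_one]
    exact FiberOps.norm_component_le a.1 u
  have hint : Integrable F μ :=
    Integrable.of_bound hF.aestronglyMeasurable (‖a‖ ^ 2) (Eventually.of_forall hle)
  have htr : traceOf μ (star a * a) = ((∫ u, F u ∂μ : ℝ) : ℂ) := by
    exact (integral_congr_ae (Eventually.of_forall fun u =>
      expectationFun_star_mul_self a u)).trans integral_ofReal
  have hmem : a ∈ tracialIdeal μ ↔ F =ᵐ[μ] 0 := by
    change traceOf μ (star a * a) = 0 ↔ _
    rw [htr, Complex.ofReal_eq_zero]
    exact integral_eq_zero_iff_of_nonneg (fun u => sq_nonneg _) hint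
  rw [hmem]
  constructor
  · intro h x hx
    rw [← hF0]
    by_contra hne
    have hnhds : {u | F u ≠ 0} ∈ 𝓝 x := (isOpen_ne_fun hF continuous_const).mem_nhds hne
    -- If F(x) ≠ 0, the open set where F ≠ 0 is a neighbourhood of a support point and has positive
    -- measure, yet it is null.
    exact (((Measure.mem_support_iff_forall x).1 hx _ hnhds).ne' (ae_iff.1 h))
  · intro h
    -- Regularity makes the complement of the support null, so vanishing on the support is vanishing
    -- almost everywhere.
    filter_upwards [Measure.support_mem_ae_of_regular (μ := μ)] with u hu
    exact (hF0 u).2 (h u hu)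

theorem mem_tracialIdeal_iff_restriction {μ : Measure (UnitSpace G)} [IsProbabilityMeasure μ]
    [μ.Regular] (hμ : IsInvariantMeasure μ) (a : ReducedCStarAlgebra G) :
    a ∈ tracialIdeal μ ↔ restriction (isInvariantSet_support hμ) a = 0 := by
  rw [mem_tracialIdeal_iff, restriction_eq_zero_iff]
  refine ⟨fun h x hx => evalReg_eq_zero_of_delta_unit (isInvariantSet_support hμ) h hx,
    fun h x hx => ?_⟩
  rw [h x hx]
  rfl

end restriction

end GroupoidCStar

theorem mainTheorem8 {G : Type u} [TopologicalSpace G] [T2Space G] [LocallyCompactSpace G]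
    [GroupoidCStar.GroupoidOn G] [GroupoidCStar.IsEtale G] [MeasurableSpace G] [BorelSpace G]
    (μ : Measure (GroupoidCStar.UnitSpace G)) [IsProbabilityMeasure μ] [μ.Regular]
    (hμ : GroupoidCStar.IsInvariantMeasure μ) :
    ∃ I : TwoSidedIdeal (GroupoidCStar.ReducedCStarAlgebra G),
      IsClosed (I : Set (GroupoidCStar.ReducedCStarAlgebra G)) ∧
      (I : Set (GroupoidCStar.ReducedCStarAlgebra G)) = GroupoidCStar.tracialIdeal μ ∧
      ∃ π : GroupoidCStar.ReducedCStarAlgebra G →⋆ₙₐ[ℂ]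
          GroupoidCStar.ReducedCStarAlgebra
            (GroupoidCStar.Reduction μ.support (GroupoidCStar.isInvariantSet_support hμ)),
        (∀ f : C_c(G, ℂ), π (GroupoidCStar.ofCc f) =
          GroupoidCStar.ofCc (GroupoidCStar.restrictCc (GroupoidCStar.isInvariantSet_support hμ) f)) ∧
        Function.Injective (Subtype.val : I → GroupoidCStar.ReducedCStarAlgebra G) ∧
        Function.Exact (Subtype.val : I → GroupoidCStar.ReducedCStarAlgebra G) π ∧
        Function.Surjective π := by
  let π := GroupoidCStar.restriction (GroupoidCStar.isInvariantSet_support hμ)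
  have hker : ∀ a, a ∈ TwoSidedIdeal.ker π ↔ π a = 0 := fun a => TwoSidedIdeal.mem_ker π
  -- With the kernel as the ideal, closedness is continuity of `π` and exactness in the middle is
  -- the definition. The trace property of τ_μ is never needed.
  refine ⟨TwoSidedIdeal.ker π, ?_, ?_, π, GroupoidCStar.restriction_ofCc,
    Subtype.val_injective, fun a => ?_, GroupoidCStar.restriction_surjective⟩
  · have e : (TwoSidedIdeal.ker π : Set (GroupoidCStar.ReducedCStarAlgebra G)) = π ⁻¹' {0} :=
      Set.ext hker
    rw [e]
    exact isClosed_singleton.preimage GroupoidCStar.continuous_restriction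
  · ext a
    exact (hker a).trans (GroupoidCStar.mem_tracialIdeal_iff_restriction hμ a).symm
  · rw [Subtype.range_coe]
    exact (hker a).symm
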